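/- **Conventions.** Let $\dot{\mathbb R}^n=\mathbb R^n\cup\{\infty\}$ be the one-point compactification of Euclidean $n$-space. $H_p$ denotes reduced singular homology with integer coefficients; a $p$-cycle is a cycle of the augmented singular chain complex; $|z|$ denotes the carrier of a singular chain $z$ (the union of the images of the simplices occurring in $z$ with non-zero coefficient). $\overline B(a,r)$ is the closed Euclidean ball. $d$ is the Euclidean distance, with $d(x,\infty)=d(\infty,x)=\infty$ for $x\in\mathbb R^n$, $d(\infty,\infty)=0$, $d(x,\varnothing)=\infty$. A *gauge* is a homeomorphism $\varphi:[0,\infty)\to[0,\infty)$ with $\varphi(r)\ge r$ for all $r$ and $r\mapsto\varphi(r)/r$ non-decreasing on $(0,\infty)$; put $\varphi(\infty)=\infty$. A domain (non-empty, open, connected set) $U\subset\dot{\mathbb R}^n$ is a *$(p,\varphi)$-John domain* if $H_p(U)=0$ and for every $p$-cycle $z$ in $U$ that bounds in $U$ there is a $(p+1)$-chain $g$ in $U$ with $\partial g=z$ and $$d(x,|z|)\le\varphi\bigl(d(x,\partial U)\bigr)\qquad\text{for all }x\in|g|.$$ A set $A\subset\dot{\mathbb R}^n$ is *homologically inner $(p,\psi)$-joinable*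 if for all $a\in A\setminus\{\infty\}$ and $r>0$ the sequence induced by inclusions $$H_p\bigl(A\setminus\overline B(a,\psi(r))\bigr)\xrightarrow{\ \alpha\ }H_p\bigl(A\setminus\overline B(a,r)\bigr)\xrightarrow{\ \beta\ }H_p(A)$$ satisfies $\ker(\beta\alpha)=\ker\alpha$. **Theorem 5.3.** For every gauge $\varphi$ there is a gauge $\psi$, depending only on $\varphi$, such that for all integers $n,p$ with $0\le p\le n-2$, every $(p,\varphi)$-John domain $U\subset\dot{\mathbb R}^n$ is homologically inner $(p,\psi)$-joinable. -/

import Mathlib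

open scoped NNReal ENNReal

noncomputable section

namespace JohnJoin

/-! ### Singular chains with supports -/

section Chains

variable {X : Type} [TopologicalSpace X]

/-- The standard (topological) `p`-simplex. -/
abbrev Simp (p : ℕ) : Type := stdSimplex ℝ (Fin (p + 1))

/-- Singular `p`-chains of `X` with integer coefficients: finite formal integral combinations of
continuous maps from the standard `p`-simplex to `X`. -/
abbrev Chain (X : Type) [TopologicalSpace X] (p : ℕ) : Type := C(Simp p, X) →₀ ℤ

/-- The `i`-th face inclusion of the standard `p`-simplex in the standard `(p+1)`-simplex. -/
def faceIncl (p : ℕ) (i : Fin (p + 2)) : C(Simp p, Simp (p + 1)) :=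
  ⟨stdSimplex.map i.succAbove, stdSimplex.continuous_map _⟩

/-- The boundary of a singular `(p+1)`-chain,
`∂ σ = ∑ i, (-1) ^ i • (σ restricted to the i-th face)`. -/
def bdry (p : ℕ) : Chain X (p + 1) →+ Chain X p :=
  Finsupp.liftAddHom fun σ =>
    ∑ i : Fin (p + 2),
      ((-1 : ℤ) ^ (i : ℕ)) • Finsupp.singleAddHom (σ.comp (faceIncl p i))

/-- The augmentation of singular `0`-chains: the sum of the coefficients. -/
def augmentation : Chain X 0 →+ ℤ := Finsupp.liftAddHom fun _ => AddMonoidHom.id ℤ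

/-- The carrier `|z|` of a singular chain `z`: the union of the images of the singular simplices
that occur in `z` with non-zero coefficient. -/
def carrier {p : ℕ} (z : Chain X p) : Set X := ⋃ σ ∈ z.support, Set.range σ

/-- The singular `p`-chains of the subspace `A`, regarded as chains of `X`: those all of whose
simplices have their image in `A`. -/
def chainsIn (A : Set X) (p : ℕ) : AddSubgroup (Chain X p) where
  carrier := {z | ∀ σ ∈ z.support, Set.range σ ⊆ A}
  zero_mem' := by simp
  add_mem' := by
    classical
    intro z w hz hw σ hσ
    rcases Finset.mem_union.1 (Finsupp.support_add hσ) with h | h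
    · exact hz σ h
    · exact hw σ h
  neg_mem' := by
    intro z hz σ hσ
    exact hz σ (by simpa using hσ)

/-- The `p`-cycles of the augmented singular chain complex (so that a `0`-cycle is a `0`-chain
whose coefficients sum to zero). -/
def cycles : (p : ℕ) → AddSubgroup (Chain X p)
  | 0 => augmentation.ker
  | p + 1 => (bdry p).ker

/-- The `p`-cycles in `A`. -/
def cyclesIn (A : Set X) (p : ℕ) : AddSubgroup (Chain X p) := chainsIn A p ⊓ cycles p

/-- The `p`-chains that bound in `A`, that is, the boundaries of `(p+1)`-chains in `A`. -/
def boundariesIn (A : Set X) (p : ℕ) : AddSubgroup (Chain X p) := (chainsIn A (p + 1)).map (bdry p)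

theorem chainsIn_mono {A B : Set X} (h : A ⊆ B) (p : ℕ) : chainsIn A p ≤ chainsIn B p :=
  fun _ hz σ hσ => (hz σ hσ).trans h

theorem mem_chainsIn_iff {A : Set X} {p : ℕ} {z : Chain X p} :
    z ∈ chainsIn A p ↔ carrier z ⊆ A := by
  simp only [carrier, Set.iUnion_subset_iff]
  rfl

theorem bdry_single (p : ℕ) (σ : C(Simp (p + 1), X)) (k : ℤ) :
    bdry p (Finsupp.single σ k) =
      ∑ i : Fin (p + 2),
        ((-1 : ℤ) ^ (i : ℕ)) • Finsupp.single (σ.comp (faceIncl p i)) k := by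
  simp [bdry]

theorem bdry_mem_chainsIn {A : Set X} {p : ℕ} {g : Chain X (p + 1)}
    (hg : g ∈ chainsIn A (p + 1)) : bdry p g ∈ chainsIn A p := by
  rw [← g.sum_single, Finsupp.sum, map_sum]
  refine sum_mem fun σ hσ => ?_
  rw [bdry_single]
  refine sum_mem fun i _ => zsmul_mem (fun τ hτ => ?_) _
  have := Finset.mem_singleton.1 (Finsupp.support_single_subset hτ)
  subst this
  rintro _ ⟨x, rfl⟩
  exact hg σ hσ ⟨_, rfl⟩

theorem faceIncl_comp (p : ℕ) (i : Fin (p + 3)) (j : Fin (p + 2)) :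
    (faceIncl (p + 1) i).comp (faceIncl p j) =
      (faceIncl (p + 1) (i.succAbove j)).comp (faceIncl p (j.predAbove i)) := by
  ext1 x
  simp only [ContinuousMap.comp_apply, faceIncl, ContinuousMap.coe_mk, stdSimplex.map_comp_apply]
  congr 1
  funext k
  simp [Function.comp, Fin.succAbove_succAbove_succAbove_predAbove]

theorem bdry_bdry (p : ℕ) (g : Chain X (p + 2)) : bdry p (bdry (p + 1) g) = 0 := by
  suffices h : (bdry p).comp (bdry (p + 1)) = (0 : Chain X (p + 2) →+ Chain X p) from
    DFunLike.congr_fun h g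
  refine Finsupp.addHom_ext fun σ k => ?_
  simp only [AddMonoidHom.comp_apply, bdry_single, map_sum, map_zsmul, AddMonoidHom.zero_apply,
    Finset.smul_sum, smul_smul, ContinuousMap.comp_assoc, ← pow_add]
  rw [← Finset.sum_product']
  refine Finset.sum_involution (fun ij _ => (ij.1.succAbove ij.2, ij.2.predAbove ij.1)) ?_ ?_ ?_ ?_
  · rintro ⟨i, j⟩ -
    simp only [← faceIncl_comp, Fin.neg_one_pow_succAbove_add_predAbove, neg_smul, add_neg_cancel]
  · rintro ⟨i, j⟩ - - h
    exact Fin.succAbove_ne i j (congrArg Prod.fst h)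
  · simp
  · rintro ⟨i, j⟩ -
    simp only [Fin.succAbove_succAbove_predAbove, Fin.predAbove_predAbove_succAbove]

theorem augmentation_bdry (g : Chain X 1) : augmentation (bdry 0 g) = 0 := by
  suffices h : augmentation.comp (bdry 0) = (0 : Chain X 1 →+ ℤ) from DFunLike.congr_fun h g
  refine Finsupp.addHom_ext fun σ k => ?_
  have h (τ : C(Simp 0, X)) : augmentation (Finsupp.single τ k) = k := by simp [augmentation]
  simp [bdry_single, -Finsupp.smul_single, h, Fin.sum_univ_two]

/-- Boundaries are cycles, so the quotient below is the homology of a chain complex. -/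
theorem boundariesIn_le_cyclesIn (A : Set X) (p : ℕ) : boundariesIn A p ≤ cyclesIn A p := by
  rintro _ ⟨g, hg, rfl⟩
  refine ⟨bdry_mem_chainsIn hg, ?_⟩
  cases p with
  | zero => exact augmentation_bdry g
  | succ p => exact bdry_bdry p g

/-- The reduced singular homology group `H_p(A)` of the subspace `A`, with integer coefficients. -/
abbrev Homology (A : Set X) (p : ℕ) : Type :=
  cyclesIn A p ⧸ (boundariesIn A p).addSubgroupOf (cyclesIn A p)

/-- The homomorphism `H_p(A) → H_p(B)` induced by an inclusion `A ⊆ B`. -/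
def homologyMap {A B : Set X} (h : A ⊆ B) (p : ℕ) : Homology A p →+ Homology B p :=
  QuotientAddGroup.map _ _
    (AddSubgroup.inclusion (inf_le_inf_right _ (chainsIn_mono h p)))
    (fun _ hz => AddSubgroup.map_mono (chainsIn_mono h (p + 1)) hz)

end Chains

/-- A short sequence `G → H → K` of groups is fast if `ker (β ∘ α) = ker α`. -/
def IsFast {G H K : Type*} [AddGroup G] [AddGroup H] [AddGroup K] (α : G →+ H) (β : H →+ K) :
    Prop :=
  (β.comp α).ker = α.ker

/-! ### The one-point compactification of Euclidean space -/

/-- Euclidean `n`-space. -/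
abbrev E (n : ℕ) : Type := EuclideanSpace ℝ (Fin n)

/-- The one-point compactification of Euclidean `n`-space. -/
abbrev DotE (n : ℕ) : Type := OnePoint (E n)

/-- The Euclidean distance, extended to the one-point compactification by declaring the point at
infinity to be at infinite distance from all other points (and at distance `0` from itself). -/
def eucDist {n : ℕ} (x y : DotE n) : ℝ≥0∞ :=
  x.elim (y.elim 0 fun _ => ⊤) fun x' => y.elim ⊤ fun y' => edist x' y'

/-- The distance from a point to a set (`∞` for the empty set). -/
def distTo {n : ℕ} (x : DotE n) (S : Set (DotE n)) : ℝ≥0∞ := ⨅ y ∈ S, eucDist x y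

/-- The closed Euclidean ball as a subset of the one-point compactification. -/
def cball {n : ℕ} (a : E n) (r : ℝ≥0) : Set (DotE n) := (↑) '' Metric.closedBall a (r : ℝ)

/-! ### Gauge functions, John domains and joinability -/

/-- A homeomorphism `φ : [0,∞) → [0,∞)` with `φ(r) ≥ r` such that `φ(r)/r` is non-decreasing on
`(0,∞)`. -/
structure Gauge where
  /-- The underlying homeomorphism. -/
  toHomeo : ℝ≥0 ≃ₜ ℝ≥0
  le_apply : ∀ r, r ≤ toHomeo r
  ratio_mono : ∀ r s, 0 < r → r ≤ s → toHomeo r / r ≤ toHomeo s / s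

instance : CoeFun Gauge fun _ => ℝ≥0 → ℝ≥0 := ⟨fun φ => φ.toHomeo⟩

/-- The extension of a gauge function to `[0,∞]` with `φ(∞) = ∞`. -/
def Gauge.ext (φ : Gauge) (t : ℝ≥0∞) : ℝ≥0∞ := if t = ⊤ then ⊤ else (φ t.toNNReal : ℝ≥0∞)

/-- `U` is a `(p, φ)`-John domain: `U` is open and connected, `H_p(U) = 0`, and each `p`-cycle `z`
that bounds in `U` is the boundary of a `(p+1)`-chain `g` in `U` with
`d(x, |z|) ≤ φ(d(x, ∂U))` for all `x ∈ |g|`. -/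
structure IsJohn {n : ℕ} (p : ℕ) (φ : Gauge) (U : Set (DotE n)) : Prop where
  isOpen : IsOpen U
  isConnected : IsConnected U
  homology_eq_zero : Subsingleton (Homology U p)
  lens : ∀ z ∈ cyclesIn U p, z ∈ boundariesIn U p →
    ∃ g ∈ chainsIn U (p + 1), bdry p g = z ∧
      ∀ x ∈ carrier g, distTo x (carrier z) ≤ φ.ext (distTo x (frontier U))

theorem diff_cball_subset {n : ℕ} (A : Set (DotE n)) (a : E n) {r s : ℝ≥0} (h : r ≤ s) :
    A \ cball a s ⊆ A \ cball a r :=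
  Set.sdiff_subset_sdiff_right
    (Set.image_mono (Metric.closedBall_subset_closedBall (NNReal.coe_le_coe.2 h)))

/-- `A` is homologically inner `(p, φ)`-joinable: for each finite point `a` of `A` and each `r > 0`
the sequence `H_p(A \ B̄(a, φ(r))) → H_p(A \ B̄(a, r)) → H_p(A)` induced by the inclusions
is fast. -/
def IsInnerJoinable {n : ℕ} (p : ℕ) (φ : Gauge) (A : Set (DotE n)) : Prop :=
  ∀ a : E n, (a : DotE n) ∈ A → ∀ r : ℝ≥0, 0 < r →
    IsFast (homologyMap (diff_cball_subset A a (φ.le_apply r)) p)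
      (homologyMap (Set.sdiff_subset : A \ cball a r ⊆ A) p)

end JohnJoin

end

noncomputable section

namespace JohnJoin

/-! ### Bernstein approximation on simplices -/

section Bernstein

/-! Take `ψ(r) = φ(6r)`. Let `z` be a cycle in `U` off `B̄(a, ψ(r))` that bounds in `U`. If `∂U`
meets `B̄(a, 3r)`, the John chain `g` with `∂g = z` already avoids `B̄(a, r)`: a point `x` of `|g|`
in that ball has `d(x, ∂U) ≤ 4r`, hence `d(x, |z|) ≤ φ(4r)`, whereas `|z|` is at distance at least
`φ(6r) - r > φ(4r)` from `x` (`Gauge.add_lt_dilate`). Otherwise `B̄(a, 3r) ⊆ U`, and any chain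
bounded by `z` in `U` can be pushed off `B̄(a, r)` (`mem_boundariesIn_diff_cball`). Near the ball
its simplices are replaced by Bernstein polynomials, whose images have dimension at most `p + 1 < n`
and so miss some `b` close to `a`; radial projection from `b` then clears the ball. Bernstein
approximation commutes with restriction to faces and the change is confined to `B̄(a, 3r)`, so the
boundary remains exactly `z`, with no homotopy correction. -/

theorem sum_prod_eq_one {ι : Type*} [Fintype ι] {t : ι → ℝ} (ht : ∑ c, t c = 1) (N : ℕ) :
    ∑ k : Fin N → ι, ∏ j, t (k j) = 1 := by
  rw [← Fintype.prod_sum (fun (_ : Fin N) => t)]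
  simp [ht]

/-- The variance of a sum of `N` independent centred variables bounded by `1` is at most `N`. -/
theorem sum_prod_mul_sq_le {ι : Type*} [Fintype ι] {t X : ι → ℝ} (h0 : ∀ c, 0 ≤ t c)
    (ht : ∑ c, t c = 1) (hX : ∑ c, t c * X c = 0) (hX1 : ∀ c, |X c| ≤ 1) (N : ℕ) :
    ∑ k : Fin N → ι, (∏ j, t (k j)) * (∑ j, X (k j)) ^ 2 ≤ N := by
  -- The weights are the law of `N` independent draws, so the off-diagonal covariances vanish.
  have key (a b : Fin N) :
      ∑ k : Fin N → ι, (∏ j, t (k j)) * (X (k a) * X (k b)) ≤ if a = b then 1 else 0 := by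
    split_ifs with hab
    · subst hab
      rw [← sum_prod_eq_one ht N]
      refine Finset.sum_le_sum fun k _ => mul_le_of_le_one_right
        (Finset.prod_nonneg fun j _ => h0 _) ?_
      rw [← abs_mul_abs_self]
      exact mul_le_one₀ (hX1 _) (abs_nonneg _) (hX1 _)
    · let g : Fin N → ι → ℝ := fun j c =>
        t c * ((if j = a then X c else 1) * (if j = b then X c else 1))
      have h1 (k : Fin N → ι) : (∏ j, t (k j)) * (X (k a) * X (k b)) = ∏ j, g j (k j) := by
        simp only [g, Finset.prod_mul_distrib, Finset.prod_ite_eq', Finset.mem_univ, if_true]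
      simp_rw [h1]
      rw [← Fintype.prod_sum g]
      refine (Finset.prod_eq_zero (Finset.mem_univ a) ?_).le
      simpa [g, hab] using hX
  calc ∑ k : Fin N → ι, (∏ j, t (k j)) * (∑ j, X (k j)) ^ 2
      = ∑ a, ∑ b, ∑ k : Fin N → ι, (∏ j, t (k j)) * (X (k a) * X (k b)) := by
        simp_rw [sq, Finset.sum_mul_sum, Finset.mul_sum]
        rw [Finset.sum_comm]
        exact Finset.sum_congr rfl fun a _ => Finset.sum_comm
    _ ≤ ∑ a : Fin N, ∑ b : Fin N, if a = b then 1 else 0 :=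
        Finset.sum_le_sum fun a _ => Finset.sum_le_sum fun b _ => key a b
    _ = N := by simp

/-- The average of the vertices `k 0, …, k N` of a simplex. -/
def vertexMean {m N : ℕ} (k : Fin (N + 1) → Fin (m + 1)) : Simp m :=
  stdSimplex.map k stdSimplex.barycenter

theorem vertexMean_apply {m N : ℕ} (k : Fin (N + 1) → Fin (m + 1)) (i : Fin (m + 1)) :
    vertexMean k i = (∑ j, if k j = i then (1 : ℝ) else 0) / (N + 1) := by
  have h (j : Fin (N + 1)) : (stdSimplex.barycenter : stdSimplex ℝ (Fin (N + 1))) j =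
      ((N : ℝ) + 1)⁻¹ := by
    change (stdSimplex.barycenter : stdSimplex ℝ (Fin (N + 1))).val j = _
    simp
  rw [vertexMean, stdSimplex.map_coe, FunOnFinite.linearMap_apply_apply, ← Finset.sum_filter,
    Finset.sum_congr rfl fun j _ => h j]
  simp [div_eq_mul_inv]

theorem faceIncl_vertexMean {m N : ℕ} (i : Fin (m + 2)) (k : Fin (N + 1) → Fin (m + 1)) :
    faceIncl m i (vertexMean k) = vertexMean (i.succAbove ∘ k) :=
  stdSimplex.map_comp_apply _ _ _

/-- The `i`-th coordinate of `vertexMean k` is the mean of `N + 1` independent indicators of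
expectation `t i`; this bounds its variance. -/
theorem sum_sq_vertexMean_sub_le {m : ℕ} (N : ℕ) (t : Simp m) (i : Fin (m + 1)) :
    ∑ k : Fin (N + 1) → Fin (m + 1), (∏ j, t (k j)) * (vertexMean k i - t i) ^ 2 ≤
      1 / (N + 1) := by
  have hN : (0 : ℝ) < N + 1 := by positivity
  have h := sum_prod_mul_sq_le (t := t) (X := fun c => (if c = i then 1 else 0) - t i)
    (fun c => stdSimplex.zero_le t c) (stdSimplex.sum_eq_one t)
    (by simp [mul_sub, Finset.sum_sub_distrib, ← Finset.sum_mul])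
    (fun c => by
      have h0 := stdSimplex.zero_le t i
      have h1 := stdSimplex.le_one t i
      rw [abs_le]; split_ifs <;> constructor <;> linarith) (N + 1)
  have h2 (k : Fin (N + 1) → Fin (m + 1)) : (∏ j, t (k j)) * (vertexMean k i - t i) ^ 2 =
      ((∏ j, t (k j)) * (∑ j, ((if k j = i then 1 else 0) - t i)) ^ 2) / (N + 1) ^ 2 := by
    rw [vertexMean_apply, Finset.sum_sub_distrib]
    simp only [Finset.sum_const, Finset.card_univ, Fintype.card_fin, nsmul_eq_mul]
    push_cast
    field_simp
  simp_rw [h2, ← Finset.sum_div]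
  rw [div_le_div_iff₀ (by positivity) hN]
  push_cast at h
  nlinarith

variable {V : Type*} [NormedAddCommGroup V] [NormedSpace ℝ V]

/-- The Bernstein polynomial of degree `N + 1` of a function on a simplex. -/
def bernsteinPoly {m : ℕ} (N : ℕ) (h : Simp m → V) (t : Fin (m + 1) → ℝ) : V :=
  ∑ k : Fin (N + 1) → Fin (m + 1), (∏ j, t (k j)) • h (vertexMean k)

theorem contDiff_bernsteinPoly {m : ℕ} (N : ℕ) (h : Simp m → V) :
    ContDiff ℝ 1 (bernsteinPoly N h) := by
  unfold bernsteinPoly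
  fun_prop

theorem faceIncl_apply_succAbove {m : ℕ} (i : Fin (m + 2)) (t : Simp m) (c : Fin (m + 1)) :
    faceIncl m i t (i.succAbove c) = t c := by
  change FunOnFinite.linearMap ℝ ℝ i.succAbove t _ = _
  rw [FunOnFinite.linearMap_apply_apply]
  simp [Finset.sum_filter]

theorem faceIncl_apply_self {m : ℕ} (i : Fin (m + 2)) (t : Simp m) : faceIncl m i t i = 0 := by
  change FunOnFinite.linearMap ℝ ℝ i.succAbove t _ = _
  rw [FunOnFinite.linearMap_apply_apply]
  simp [Fin.succAbove_ne]

/-- On the `i`-th face `t i = 0`, so only tuples `k` avoiding the vertex `i` contribute. This makes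
approximation compatible with `bdry`. -/
theorem bernsteinPoly_comp_faceIncl {m : ℕ} (N : ℕ) (h : Simp (m + 1) → V) (i : Fin (m + 2))
    (t : Simp m) :
    bernsteinPoly N (h ∘ faceIncl m i) t = bernsteinPoly N h (faceIncl m i t) := by
  unfold bernsteinPoly
  have inj : Function.Injective
      (fun k : Fin (N + 1) → Fin (m + 1) => (i.succAbove ∘ k : Fin (N + 1) → Fin (m + 2))) :=
    fun _ _ h => funext fun j => Fin.succAbove_right_injective (congrFun h j)
  refine Fintype.sum_of_injective _ inj _ _ (fun k hk => ?_) fun k => ?_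
  · obtain ⟨j, hj⟩ : ∃ j, k j = i := by
      by_contra! hne
      choose l hl using fun j => Fin.exists_succAbove_eq (hne j)
      exact hk ⟨l, funext hl⟩
    rw [Finset.prod_eq_zero (Finset.mem_univ j), zero_smul]
    rw [hj, faceIncl_apply_self]
  · simp only [Function.comp_apply, faceIncl_apply_succAbove, faceIncl_vertexMean]

/-- Bernstein polynomials of a continuous function on a simplex converge uniformly. -/
theorem eventually_norm_bernsteinPoly_sub_le {m : ℕ} (h : C(Simp m, V)) {ε : ℝ} (hε : 0 < ε) :
    ∀ᶠ N in Filter.atTop, ∀ t : Simp m, ‖bernsteinPoly N h t - h t‖ ≤ ε := by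
  obtain ⟨δ, hδ, hu⟩ := Metric.uniformContinuous_iff.1
    (CompactSpace.uniformContinuous_of_continuous h.continuous) (ε / 2) (half_pos hε)
  -- Chebyshev's argument: uniform continuity when the mean is within `δ` of `t`; otherwise the sum
  -- of squares is at least `δ ^ 2`.
  have bound (N : ℕ) (k : Fin (N + 1) → Fin (m + 1)) (t : Simp m) :
      ‖h (vertexMean k) - h t‖ ≤
        ε / 2 + 2 * ‖h‖ / δ ^ 2 * ∑ i, (vertexMean k i - t i) ^ 2 := by
    have hs : 0 ≤ ∑ i, (vertexMean k i - t i) ^ 2 := Finset.sum_nonneg fun i _ => sq_nonneg _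
    by_cases hd : dist (vertexMean k) t < δ
    · have h1 := hu hd
      rw [dist_eq_norm] at h1
      have : 0 ≤ 2 * ‖h‖ / δ ^ 2 * ∑ i, (vertexMean k i - t i) ^ 2 := by positivity
      linarith
    · obtain ⟨i, hi⟩ : ∃ i, δ ≤ |vertexMean k i - t i| := by
        by_contra! hlt
        exact hd ((dist_pi_lt_iff hδ).2 fun i => by rw [Real.dist_eq]; exact hlt i)
      have h2 : δ ^ 2 ≤ ∑ i, (vertexMean k i - t i) ^ 2 := by
        refine le_trans ?_ (Finset.single_le_sum (f := fun i => (vertexMean k i - t i) ^ 2)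
          (fun i _ => sq_nonneg _) (Finset.mem_univ i))
        rw [← sq_abs (vertexMean k i - t i)]
        gcongr
      have h3 : ‖h (vertexMean k) - h t‖ ≤ 2 * ‖h‖ := by
        have := norm_sub_le (h (vertexMean k)) (h t)
        linarith [h.norm_coe_le_norm (vertexMean k), h.norm_coe_le_norm t]
      have h4 : 2 * ‖h‖ ≤ 2 * ‖h‖ / δ ^ 2 * ∑ i, (vertexMean k i - t i) ^ 2 := by
        rw [div_mul_eq_mul_div, le_div_iff₀ (by positivity)]
        gcongr
      linarith
  have total (N : ℕ) (t : Simp m) : ‖bernsteinPoly N h t - h t‖ ≤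
      ε / 2 + 2 * ‖h‖ / δ ^ 2 * ((m + 1) * (1 / (N + 1))) := by
    have hone := sum_prod_eq_one (stdSimplex.sum_eq_one t) (N + 1)
    have hpos (k : Fin (N + 1) → Fin (m + 1)) : 0 ≤ ∏ j, t (k j) :=
      Finset.prod_nonneg fun j _ => stdSimplex.zero_le t _
    have hrw : bernsteinPoly N h t - h t =
        ∑ k : Fin (N + 1) → Fin (m + 1), (∏ j, t (k j)) • (h (vertexMean k) - h t) := by
      simp_rw [smul_sub, Finset.sum_sub_distrib, ← Finset.sum_smul, hone, one_smul]
      rfl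
    rw [hrw]
    calc _ ≤ ∑ k : Fin (N + 1) → Fin (m + 1), (∏ j, t (k j)) *
          (ε / 2 + 2 * ‖h‖ / δ ^ 2 * ∑ i, (vertexMean k i - t i) ^ 2) := by
          refine norm_sum_le_of_le _ fun k _ => ?_
          rw [norm_smul, Real.norm_of_nonneg (hpos k)]
          exact mul_le_mul_of_nonneg_left (bound N k t) (hpos k)
      _ = ε / 2 + 2 * ‖h‖ / δ ^ 2 * ∑ i, ∑ k : Fin (N + 1) → Fin (m + 1),
            (∏ j, t (k j)) * (vertexMean k i - t i) ^ 2 := by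
          simp_rw [mul_add, Finset.sum_add_distrib, ← Finset.sum_mul, hone, one_mul]
          rw [Finset.sum_comm]
          simp_rw [Finset.mul_sum]
          congr 1
          exact Finset.sum_congr rfl fun k _ => Finset.sum_congr rfl fun i _ => by ring
      _ ≤ ε / 2 + 2 * ‖h‖ / δ ^ 2 * ∑ i : Fin (m + 1), (1 / ((N : ℝ) + 1)) := by
          gcongr with i
          exact sum_sq_vertexMean_sub_le N t i
      _ = _ := by simp
  have lim : Filter.Tendsto (fun N : ℕ => 2 * ‖h‖ / δ ^ 2 * ((m + 1) * (1 / ((N : ℝ) + 1))))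
      Filter.atTop (nhds 0) := by
    simpa using (tendsto_one_div_add_atTop_nhds_zero_nat (𝕜 := ℝ)).const_mul ((m : ℝ) + 1)
      |>.const_mul (2 * ‖h‖ / δ ^ 2)
  filter_upwards [lim.eventually (gt_mem_nhds (half_pos hε))] with N hN t
  linarith [total N t]

/-- The image of an `m`-simplex under a `C¹` map has dimension at most `m`. -/
theorem dimH_image_simp_le {m : ℕ} {F : (Fin (m + 1) → ℝ) → V} (hF : ContDiff ℝ 1 F) :
    dimH (Set.range fun t : Simp m => F t) ≤ m := by
  -- Dropping the first barycentric coordinate parametrises the simplex by `m` reals; the domain of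
  -- `F` itself would only give `m + 1`.
  let u : (Fin m → ℝ) → (Fin (m + 1) → ℝ) := fun x => Fin.cons (1 - ∑ i, x i) x
  have hu : ContDiff ℝ 1 u := by
    refine contDiff_pi.2 fun i => ?_
    refine Fin.cases ?_ (fun i => ?_) i
    · simp only [u, Fin.cons_zero]; fun_prop
    · simp only [u, Fin.cons_succ]; fun_prop
  refine (dimH_mono ?_).trans ((hF.comp hu).dimH_range_le.trans (by simp))
  rintro _ ⟨t, rfl⟩
  refine ⟨fun i => t i.succ, congrArg F (funext fun i => ?_)⟩
  have := stdSimplex.sum_eq_one t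
  rw [Fin.sum_univ_succ] at this
  refine Fin.cases ?_ (fun i => ?_) i
  · simp only [u, Fin.cons_zero]; exact sub_eq_of_eq_add this.symm
  · rfl

end Bernstein

/-! ### Replacing the simplices of a chain -/

section Replace

variable {X : Type} [TopologicalSpace X]

theorem bdry_mapDomain {p : ℕ} (F : C(Simp (p + 1), X) → C(Simp (p + 1), X))
    (F' : C(Simp p, X) → C(Simp p, X)) (g : Chain X (p + 1))
    (h : ∀ σ ∈ g.support, ∀ i, F' (σ.comp (faceIncl p i)) = (F σ).comp (faceIncl p i)) :
    bdry p (Finsupp.mapDomain F g) = Finsupp.mapDomain F' (bdry p g) := by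
  have key (σ : C(Simp (p + 1), X)) (hσ : σ ∈ g.support) :
      bdry p (Finsupp.single (F σ) (g σ)) =
        Finsupp.mapDomain.addMonoidHom F' (bdry p (Finsupp.single σ (g σ))) := by
    rw [bdry_single, bdry_single, map_sum]
    refine Finset.sum_congr rfl fun i _ => ?_
    rw [map_zsmul, ← h σ hσ i]
    exact congrArg _ Finsupp.mapDomain_single.symm
  change _ = Finsupp.mapDomain.addMonoidHom F' (bdry p g)
  conv_rhs => rw [← g.sum_single, Finsupp.sum, map_sum, map_sum]
  rw [Finsupp.mapDomain, Finsupp.sum, map_sum]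
  exact Finset.sum_congr rfl key

theorem mapDomain_mem_chainsIn {p : ℕ} {A : Set X} {F : C(Simp p, X) → C(Simp p, X)}
    {g : Chain X p} (h : ∀ σ ∈ g.support, ∀ t, F σ t ∈ A) :
    Finsupp.mapDomain F g ∈ chainsIn A p := by
  classical
  intro σ hσ
  obtain ⟨τ, hτ, rfl⟩ := Finset.mem_image.1 (Finsupp.mapDomain_support hσ)
  rintro _ ⟨t, rfl⟩
  exact h τ hτ t

theorem mapDomain_eq_self {p : ℕ} {F : C(Simp p, X) → C(Simp p, X)}
    {z : Chain X p} (h : ∀ σ ∈ z.support, F σ = σ) : Finsupp.mapDomain F z = z := by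
  rw [Finsupp.mapDomain_congr h]
  exact Finsupp.mapDomain_id

end Replace

/-! ### Pushing simplices out of a ball -/

section Push

variable {n : ℕ}

theorem coe_mem_cball {a x : E n} {r : ℝ≥0} : (x : DotE n) ∈ cball a r ↔ ‖x - a‖ ≤ r := by
  simp [cball, dist_eq_norm]

theorem isClosed_cball (a : E n) (r : ℝ≥0) : IsClosed (cball a r) :=
  ((isCompact_closedBall a (r : ℝ)).image OnePoint.continuous_coe).isClosed

/-- The radial projection onto the complement of the open ball of centre `b` and radius `ρ`. -/
def pushOut (b : E n) (ρ : ℝ) (x : E n) : E n := b + max 1 (ρ / ‖x - b‖) • (x - b)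

theorem continuousAt_pushOut {b x : E n} (ρ : ℝ) (hx : x ≠ b) : ContinuousAt (pushOut b ρ) x := by
  have : ‖x - b‖ ≠ 0 := by simpa [sub_eq_zero] using hx
  unfold pushOut
  fun_prop (disch := assumption)

theorem pushOut_eq_self {b x : E n} {ρ : ℝ} (h : ρ ≤ ‖x - b‖) : pushOut b ρ x = x := by
  have : ρ / ‖x - b‖ ≤ 1 := div_le_one_of_le₀ h (norm_nonneg _)
  simp [pushOut, max_eq_left this]

theorem norm_pushOut_sub {b x : E n} (ρ : ℝ) (hx : x ≠ b) :
    ‖pushOut b ρ x - b‖ = max ‖x - b‖ ρ := by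
  have h : 0 < ‖x - b‖ := norm_pos_iff.2 (sub_ne_zero.2 hx)
  rw [pushOut, add_sub_cancel_left, norm_smul,
    Real.norm_of_nonneg (zero_le_one.trans (le_max_left _ _)), max_mul_of_nonneg _ _ h.le,
    one_mul, div_mul_cancel₀ _ (ne_of_gt h)]

/-- A cut-off function, equal to `1` on `B̄(a, 2r)` and to `0` off `B(a, 5r/2)`. -/
def cutoff (a : E n) (r : ℝ) (x : E n) : ℝ := max 0 (min 1 (5 - 2 * (‖x - a‖ / r)))

theorem continuous_cutoff (a : E n) (r : ℝ) : Continuous (cutoff a r) := by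
  unfold cutoff
  fun_prop

theorem abs_cutoff_le_one (a : E n) (r : ℝ) (x : E n) : |cutoff a r x| ≤ 1 := by
  rw [cutoff, abs_of_nonneg (le_max_left _ _)]
  exact max_le zero_le_one (min_le_left _ _)

theorem cutoff_eq_one {a x : E n} {r : ℝ} (hr : 0 < r) (h : ‖x - a‖ ≤ 2 * r) :
    cutoff a r x = 1 := by
  have : ‖x - a‖ / r ≤ 2 := (div_le_iff₀ hr).2 h
  rw [cutoff, min_eq_left (by linarith), max_eq_right zero_le_one]

theorem cutoff_eq_zero {a x : E n} {r : ℝ} (hr : 0 < r) (h : 5 / 2 * r ≤ ‖x - a‖) :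
    cutoff a r x = 0 := by
  have : 5 / 2 ≤ ‖x - a‖ / r := (le_div_iff₀ hr).2 h
  exact max_eq_left ((min_le_right _ _).trans (by linarith))

/-- The interpolation between `y` (for `x` near `a`) and `x` (for `x` far from `a`). -/
def blend (a : E n) (r : ℝ) (x y : E n) : E n := x + cutoff a r x • (y - x)

theorem norm_blend_sub_le (a : E n) (r : ℝ) (x y : E n) : ‖blend a r x y - x‖ ≤ ‖y - x‖ := by
  rw [blend, add_sub_cancel_left, norm_smul, Real.norm_eq_abs]
  exact mul_le_of_le_one_left (norm_nonneg _) (abs_cutoff_le_one a r x)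

/-- Where `‖x - a‖ ≤ 2r` the blend is `y`; farther out it moves `x` by at most `r/4`, too little to
come within `r/4` of `a`. -/
theorem blend_ne {a b x y : E n} {r : ℝ} (hr : 0 < r) (hb : ‖b - a‖ ≤ r / 4)
    (hxy : ‖y - x‖ ≤ r / 4) (hy : y ≠ b) : blend a r x y ≠ b := by
  rcases le_total ‖x - a‖ (2 * r) with h | h
  · simpa [blend, cutoff_eq_one hr h] using hy
  · rintro rfl
    have h1 := norm_blend_sub_le a r x y
    have h2 : ‖x - a‖ ≤ ‖blend a r x y - x‖ + ‖blend a r x y - a‖ := by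
      rw [norm_sub_rev (blend a r x y) x]
      exact norm_sub_le_norm_sub_add_norm_sub _ _ _
    linarith

theorem pushOut_blend_eq_self {a b x y : E n} {r : ℝ} (hr : 0 < r) (hb : ‖b - a‖ ≤ r / 4)
    (hx : 5 / 2 * r ≤ ‖x - a‖) : pushOut b (3 / 2 * r) (blend a r x y) = x := by
  have h : ‖x - a‖ ≤ ‖x - b‖ + ‖b - a‖ := norm_sub_le_norm_sub_add_norm_sub _ _ _
  rw [blend, cutoff_eq_zero hr hx, zero_smul, add_zero, pushOut_eq_self (by linarith)]

open Classical in
/-- Inside `B̄(a, 3r)`, a map from a simplex is blended with the Bernstein polynomial of its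
composition with `f` and then pushed away from `b`. -/
def perturb (f : DotE n → E n) (a b : E n) (r : ℝ≥0) (N : ℕ) {m : ℕ} (σ : Simp m → DotE n)
    (t : Simp m) : DotE n :=
  if σ t ∈ cball a (3 * r) then
    ((pushOut b (3 / 2 * r) (blend a r (f (σ t)) (bernsteinPoly N (f ∘ σ) t)) : E n) : DotE n)
  else σ t

open Classical in
/-- The perturbation of a singular simplex, when it is continuous. -/
def perturbSimp (f : DotE n → E n) (a b : E n) (r : ℝ≥0) (N : ℕ) {m : ℕ}
    (σ : C(Simp m, DotE n)) : C(Simp m, DotE n) :=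
  if h : Continuous (perturb f a b r N σ) then ⟨_, h⟩ else σ

variable {f : DotE n → E n} {a b : E n} {r : ℝ≥0} {N m : ℕ}

theorem perturb_comp_faceIncl (σ : Simp (m + 1) → DotE n) (i : Fin (m + 2)) (t : Simp m) :
    perturb f a b r N (σ ∘ faceIncl m i) t = perturb f a b r N σ (faceIncl m i t) := by
  simp only [perturb, Function.comp_apply, ← Function.comp_assoc, bernsteinPoly_comp_faceIncl]

theorem perturbSimp_apply {σ : C(Simp m, DotE n)} (h : Continuous (perturb f a b r N σ))
    (t : Simp m) : perturbSimp f a b r N σ t = perturb f a b r N σ t := by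
  simp [perturbSimp, h]

theorem perturbSimp_comp_faceIncl {σ : C(Simp (m + 1), DotE n)}
    (h : Continuous (perturb f a b r N σ)) (i : Fin (m + 2)) :
    perturbSimp f a b r N (σ.comp (faceIncl m i)) =
      (perturbSimp f a b r N σ).comp (faceIncl m i) := by
  have e : perturb f a b r N (σ.comp (faceIncl m i)) =
      perturb f a b r N σ ∘ faceIncl m i := funext (perturb_comp_faceIncl σ i)
  ext1 t
  rw [perturbSimp_apply (e ▸ h.comp (faceIncl m i).continuous), e, ContinuousMap.comp_apply,
    perturbSimp_apply h, Function.comp_apply]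

theorem perturbSimp_eq_self {σ : C(Simp m, DotE n)} (h : ∀ t, σ t ∉ cball a (3 * r)) :
    perturbSimp f a b r N σ = σ := by
  have e : perturb f a b r N σ = σ := funext fun t => if_neg (h t)
  ext1 t
  rw [perturbSimp_apply (by rw [e]; exact σ.continuous), e]

/-- The two formulas agree on the shell between radii `5r/2` and `3r`, where the cut-off vanishes
and `pushOut` is the identity. Inside, the blend never hits the singularity `b` of `pushOut`. -/
theorem continuous_perturb (hf : Continuous f) (hfa : ∀ x : E n, ‖x - a‖ ≤ 3 * r → f x = x)
    (hr : 0 < r) (hb : ‖b - a‖ ≤ r / 4) {σ : C(Simp m, DotE n)}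
    (h1 : ∀ t : Simp m, ‖bernsteinPoly N (f ∘ σ) t - f (σ t)‖ ≤ r / 4)
    (h2 : ∀ t : Simp m, bernsteinPoly N (f ∘ σ) t ≠ b) : Continuous (perturb f a b r N σ) := by
  have hr' : (0 : ℝ) < r := hr
  refine continuous_iff_continuousAt.2 fun t => ?_
  by_cases ht : σ t ∈ cball a (5 / 2 * r)
  · obtain ⟨x, hx, hxt⟩ := ht
    have hopen : IsOpen (((↑) : E n → DotE n) '' Metric.ball a (3 * r)) :=
      OnePoint.isOpenEmbedding_coe.isOpenMap _ Metric.isOpen_ball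
    have hmem : σ t ∈ ((↑) : E n → DotE n) '' Metric.ball a (3 * r) := by
      refine ⟨x, ?_, hxt⟩
      rw [Metric.mem_closedBall] at hx
      rw [Metric.mem_ball]
      push_cast at hx
      linarith
    have ev : (fun s => ((pushOut b (3 / 2 * r) (blend a r (f (σ s))
        (bernsteinPoly N (f ∘ σ) s)) : E n) : DotE n)) =ᶠ[nhds t] perturb f a b r N σ := by
      filter_upwards [σ.continuous.continuousAt.preimage_mem_nhds (hopen.mem_nhds hmem)]
        with s hs
      refine (if_pos ?_).symm
      obtain ⟨y, hy, hys⟩ := hs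
      exact ⟨y, by simpa using (Metric.mem_ball.1 hy).le, hys⟩
    refine ContinuousAt.congr ?_ ev
    refine OnePoint.continuous_coe.continuousAt.comp
      (ContinuousAt.comp (f := fun s : Simp m => blend a r (f (σ s)) (bernsteinPoly N (f ∘ σ) s))
        (continuousAt_pushOut _ (blend_ne hr' hb (h1 t) (h2 t))) ?_)
    have c1 : Continuous fun s : Simp m => bernsteinPoly N (f ∘ σ) (s : Fin (m + 1) → ℝ) :=
      (contDiff_bernsteinPoly N (f ∘ σ)).continuous.comp continuous_subtype_val
    have c2 : Continuous fun s : Simp m => f (σ s) := hf.comp σ.continuous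
    exact (c2.add (((continuous_cutoff a r).comp c2).smul (c1.sub c2))).continuousAt
  · refine σ.continuous.continuousAt.congr ?_
    filter_upwards [σ.continuous.continuousAt.preimage_mem_nhds
      ((isClosed_cball a (5 / 2 * r)).isOpen_compl.mem_nhds ht)] with s hs
    unfold perturb
    split_ifs with h
    · obtain ⟨y, hy, hys⟩ := h
      have hs' : σ s ∉ cball a (5 / 2 * r) := hs
      rw [← hys, coe_mem_cball, not_le] at hs'
      rw [← hys, hfa y (by simpa [dist_eq_norm] using hy), pushOut_blend_eq_self hr' hb]
      push_cast at hs'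
      exact hs'.le
    · rfl

/-- Pushed points are at least `3r/2` from `b`, hence at least `5r/4` from `a`. A point starting
within `5r/2` of `a` ends within `11r/4` or on the sphere of radius `3r/2` about `b`, so it stays in
`B̄(a, 3r) ⊆ U`. -/
theorem perturb_mem (hfa : ∀ x : E n, ‖x - a‖ ≤ 3 * r → f x = x)
    (hr : 0 < r) (hb : ‖b - a‖ < r / 4) {σ : C(Simp m, DotE n)}
    (h1 : ∀ t : Simp m, ‖bernsteinPoly N (f ∘ σ) t - f (σ t)‖ ≤ r / 4)
    (h2 : ∀ t : Simp m, bernsteinPoly N (f ∘ σ) t ≠ b) {U : Set (DotE n)}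
    (hU : cball a (3 * r) ⊆ U) (hσ : ∀ t, σ t ∈ U) (t : Simp m) :
    perturb f a b r N σ t ∈ U \ cball a r := by
  have hr' : (0 : ℝ) < r := hr
  unfold perturb
  split_ifs with h
  · obtain ⟨y, hy, hyt⟩ := h
    have hy' : ‖y - a‖ ≤ 3 * r := by simpa [dist_eq_norm] using hy
    have h1' := h1 t
    rw [← hyt, hfa y hy'] at h1' ⊢
    set w := blend a r y (bernsteinPoly N (f ∘ σ) t) with hw
    have hwb : w ≠ b := blend_ne hr' hb.le h1' (h2 t)
    have hn := norm_pushOut_sub (3 / 2 * (r : ℝ)) hwb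
    constructor
    · refine hU (coe_mem_cball.2 ?_)
      push_cast
      rcases le_total (5 / 2 * (r : ℝ)) ‖y - a‖ with h5 | h5
      · rwa [pushOut_blend_eq_self hr' hb.le h5]
      · rcases le_total (3 / 2 * (r : ℝ)) ‖w - b‖ with h3 | h3
        · rw [pushOut_eq_self h3]
          have := norm_blend_sub_le a r y (bernsteinPoly N (f ∘ σ) t)
          have := norm_sub_le_norm_sub_add_norm_sub w y a
          linarith
        · rw [max_eq_right h3] at hn
          have := norm_sub_le_norm_sub_add_norm_sub (pushOut b (3 / 2 * r) w) b a
          linarith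
    · rw [coe_mem_cball, not_le]
      have h3 : 3 / 2 * (r : ℝ) ≤ ‖pushOut b (3 / 2 * r) w - b‖ := hn ▸ le_max_right _ _
      have := norm_sub_le_norm_sub_add_norm_sub (pushOut b (3 / 2 * r) w) a b
      rw [norm_sub_rev a b] at this
      linarith
  · exact diff_cball_subset U a (le_mul_of_one_le_left' (by norm_num)) ⟨hσ t, h⟩

/-- Tietze extension. Bernstein polynomials need vector values, but simplices may leave the ball or
pass through `∞`. -/
theorem exists_continuous_eq_id_on_cball (a : E n) (R : ℝ) :
    ∃ f : DotE n → E n, Continuous f ∧ ∀ x : E n, ‖x - a‖ ≤ R → f x = x := by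
  have he : Topology.IsClosedEmbedding
      (fun x : Metric.closedBall a R => ((x : E n) : DotE n)) :=
    (OnePoint.continuous_coe.comp continuous_subtype_val).isClosedEmbedding
      (OnePoint.coe_injective.comp Subtype.val_injective)
  obtain ⟨g, hg⟩ := ContinuousMap.exists_extension' he
    (⟨Subtype.val, continuous_subtype_val⟩ : C(Metric.closedBall a R, E n))
  exact ⟨g, g.continuous, fun x hx =>
    congrFun hg ⟨x, mem_closedBall_iff_norm.2 hx⟩⟩

/-- A `p`-cycle off a ball `B̄(a, 3r)` in `U` that bounds in `U` bounds in `U` off `B̄(a, r)`, as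
long as `p + 1` is less than the dimension of the space. -/
theorem mem_boundariesIn_diff_cball {p : ℕ} (hpn : p + 2 ≤ n) {U : Set (DotE n)} (hr : 0 < r)
    (hU : cball a (3 * r) ⊆ U) {z : Chain (DotE n) p} (hz : z ∈ chainsIn (cball a (3 * r))ᶜ p)
    (hzU : z ∈ boundariesIn U p) : z ∈ boundariesIn (U \ cball a r) p := by
  have hr' : (0 : ℝ) < r := hr
  obtain ⟨g, hg, rfl⟩ := hzU
  obtain ⟨f, hf, hfa⟩ := exists_continuous_eq_id_on_cball a (3 * r)
  have hev : ∀ᶠ N in Filter.atTop, ∀ σ ∈ g.support, ∀ t : Simp (p + 1),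
      ‖bernsteinPoly N (f ∘ σ) t - f (σ t)‖ ≤ r / 4 :=
    (Filter.eventually_all_finset _).2 fun σ _ =>
      eventually_norm_bernsteinPoly_sub_le ((⟨f, hf⟩ : C(DotE n, E n)).comp σ) (by positivity)
  obtain ⟨N, hN⟩ := hev.exists
  have hdim : dimH (⋃ σ ∈ g.support,
      Set.range fun t : Simp (p + 1) => bernsteinPoly N (f ∘ σ) t) < Module.finrank ℝ (E n) := by
    rw [finrank_euclideanSpace_fin]
    refine lt_of_le_of_lt (b := ((p + 1 : ℕ) : ℝ≥0∞)) ?_ (by exact_mod_cast hpn)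
    refine (dimH_bUnion (Finset.countable_toSet g.support) _).trans_le (iSup₂_le fun σ _ => ?_)
    exact dimH_image_simp_le (contDiff_bernsteinPoly N (f ∘ σ))
  obtain ⟨b, hbg, hbr⟩ := (dense_compl_of_dimH_lt_finrank hdim).exists_dist_lt a
    (show 0 < (r : ℝ) / 4 by positivity)
  rw [dist_comm, dist_eq_norm] at hbr
  have hbg' : ∀ σ ∈ g.support, ∀ t : Simp (p + 1), bernsteinPoly N (f ∘ σ) t ≠ b :=
    fun σ hσ t h => hbg (Set.mem_biUnion hσ ⟨t, h⟩)
  have hcont : ∀ σ ∈ g.support, Continuous (perturb f a b r N σ) := fun σ hσ =>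
    continuous_perturb hf hfa hr hbr.le (hN σ hσ) (hbg' σ hσ)
  refine ⟨Finsupp.mapDomain (perturbSimp f a b r N) g, mapDomain_mem_chainsIn fun σ hσ t => ?_, ?_⟩
  · rw [perturbSimp_apply (hcont σ hσ)]
    exact perturb_mem hfa hr hbr (hN σ hσ) (hbg' σ hσ) hU (fun s => hg σ hσ ⟨s, rfl⟩) t
  -- The simplices of `z` avoid `B̄(a, 3r)`, so the perturbation fixes them.
  · rw [bdry_mapDomain _ (perturbSimp f a b r N) g fun σ hσ i =>
      perturbSimp_comp_faceIncl (hcont σ hσ) i]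
    exact mapDomain_eq_self fun σ hσ => perturbSimp_eq_self fun t => hz σ hσ ⟨t, rfl⟩

end Push

/-! ### Chains of John domains -/

section Join

variable {n : ℕ}

/-- A connected set that contains `a` and has no boundary point in `B̄(a, R)` contains
`B̄(a, R)`. -/
theorem cball_subset_of_disjoint_frontier {a : E n} {R : ℝ≥0} {U : Set (DotE n)}
    (ha : (a : DotE n) ∈ U) (h : Disjoint (cball a R) (frontier U)) : cball a R ⊆ U := by
  have hpre : IsPreconnected (cball a R) :=
    (convex_closedBall a (R : ℝ)).isPreconnected.image _ OnePoint.continuous_coe.continuousOn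
  have hcov : cball a R ⊆ interior U ∪ interior Uᶜ := by
    intro x hx
    by_contra hx'
    rw [Set.mem_union, not_or, interior_compl, Set.notMem_compl_iff] at hx'
    exact h.notMem_of_mem_left hx hx'.symm
  refine (hpre.subset_left_of_subset_union isOpen_interior isOpen_interior
    (disjoint_compl_right.mono interior_subset interior_subset) hcov
    ⟨a, ?_⟩).trans interior_subset
  have haR : (a : DotE n) ∈ cball a R := coe_mem_cball.2 (by simp)
  exact ⟨haR, (hcov haR).resolve_right fun h' => interior_subset h' ha⟩

theorem eucDist_coe (x y : E n) : eucDist (x : DotE n) y = edist x y := rfl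

/-- A point of `B̄(a, r)` whose distance to the complement of `B̄(a, R)` is at most `ρ` forces
`R ≤ r + ρ`. -/
theorem le_add_of_distTo_le {a : E n} {R r ρ : ℝ≥0} {S : Set (DotE n)} (hS : S ⊆ (cball a R)ᶜ)
    {x : DotE n} (hx : x ∈ cball a r) (h : distTo x S ≤ ρ) : R ≤ r + ρ := by
  obtain ⟨x, hx, rfl⟩ := hx
  rw [← tsub_le_iff_left, ← ENNReal.coe_le_coe]
  refine le_trans (le_iInf₂ fun y hy => ?_) h
  induction y using OnePoint.rec with
  | infty => exact le_top
  | coe y =>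
    have hy' : y ∉ Metric.closedBall a (R : ℝ) := fun h' => hS hy ⟨y, h', rfl⟩
    rw [eucDist_coe, edist_nndist, ENNReal.coe_le_coe, tsub_le_iff_left, ← NNReal.coe_le_coe]
    rw [Metric.mem_closedBall, not_le] at hy'
    rw [Metric.mem_closedBall] at hx
    push_cast
    linarith [dist_triangle_left y a x]

/-! ### Gauge inequalities -/

theorem Gauge.apply_zero (φ : Gauge) : φ 0 = 0 := by
  obtain ⟨t, ht⟩ := φ.toHomeo.surjective 0
  have h0 : t = 0 := le_antisymm (ht ▸ φ.le_apply t) bot_le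
  rwa [h0] at ht

theorem Gauge.mul_apply_le (φ : Gauge) {r s : ℝ≥0} (hr : 0 < r) (h : r ≤ s) :
    s * φ r ≤ r * φ s := by
  have := φ.ratio_mono r s hr h
  rwa [div_le_div_iff₀ hr (hr.trans_le h), mul_comm, mul_comm _ r] at this

theorem Gauge.monotone (φ : Gauge) : Monotone φ.toHomeo := by
  intro r s h
  rcases eq_zero_or_pos r with rfl | hr
  · rw [φ.apply_zero]; exact bot_le
  · exact le_of_mul_le_mul_left
      ((mul_le_mul_left h (φ r)).trans (φ.mul_apply_le hr h)) hr

/-- The gauge `r ↦ φ (6 r)`. -/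
def Gauge.dilate (φ : Gauge) : Gauge where
  toHomeo := (Homeomorph.mulLeft₀ (6 : ℝ≥0) (by norm_num)).trans φ.toHomeo
  le_apply r := (le_mul_of_one_le_left' (by norm_num)).trans (φ.le_apply (6 * r))
  ratio_mono r s hr hrs := by
    have h := φ.mul_apply_le (r := 6 * r) (s := 6 * s) (by positivity) (by gcongr)
    rw [div_le_div_iff₀ hr (hr.trans_le hrs)]
    change φ (6 * r) * s ≤ φ (6 * s) * r
    refine le_of_mul_le_mul_left (a := 6) ?_ (by norm_num)
    calc 6 * (φ (6 * r) * s) = 6 * s * φ (6 * r) := by ring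
      _ ≤ 6 * r * φ (6 * s) := h
      _ = 6 * (φ (6 * s) * r) := by ring

theorem Gauge.dilate_apply (φ : Gauge) (r : ℝ≥0) : φ.dilate r = φ (6 * r) := rfl

/-- Monotonicity of the ratio gives `φ(6r) ≥ (3/2) φ(4r)`, and half of `φ(4r)` is at least `2r > r`.
-/
theorem Gauge.add_lt_dilate (φ : Gauge) {r : ℝ≥0} (hr : 0 < r) :
    r + φ (4 * r) < φ.dilate r := by
  have h := φ.mul_apply_le (r := 4 * r) (s := 6 * r) (by positivity) (by gcongr; norm_num)
  have h4 := φ.le_apply (4 * r)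
  rw [φ.dilate_apply]
  rw [mul_right_comm, mul_right_comm 4] at h
  have h' := NNReal.coe_le_coe.2 (le_of_mul_le_mul_right h hr)
  have h4' := NNReal.coe_le_coe.2 h4
  rw [← NNReal.coe_lt_coe]
  push_cast at *
  have : (0 : ℝ) < r := hr
  linarith

/-- A John domain is joinable for every sufficiently large gauge. -/
theorem IsJohn.mem_boundariesIn {p : ℕ} (hpn : p + 2 ≤ n) {φ : Gauge} {U : Set (DotE n)}
    (hU : IsJohn p φ U) {a : E n} (ha : (a : DotE n) ∈ U) {r R : ℝ≥0} (hr : 0 < r)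
    (hR : 3 * r ≤ R) (hφR : r + φ (4 * r) < R) {z : Chain (DotE n) p}
    (hz : z ∈ cyclesIn (U \ cball a R) p) (hzU : z ∈ boundariesIn U p) :
    z ∈ boundariesIn (U \ cball a r) p := by
  by_cases hd : Disjoint (cball a (3 * r)) (frontier U)
  · exact mem_boundariesIn_diff_cball hpn hr (cball_subset_of_disjoint_frontier ha hd)
      (chainsIn_mono (fun x hx => (diff_cball_subset U a hR hx).2) p hz.1) hzU
  · obtain ⟨y, hya, hyU⟩ := Set.not_disjoint_iff.1 hd
    obtain ⟨g, hg, rfl, hgφ⟩ := hU.lens z (boundariesIn_le_cyclesIn U p hzU) hzU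
    refine ⟨g, mem_chainsIn_iff.2 fun x hx => ⟨mem_chainsIn_iff.1 hg hx, fun hxa => ?_⟩, rfl⟩
    -- `4r = r + 3r`, through the centre `a`.
    have h1 : distTo x (frontier U) ≤ (4 * r : ℝ≥0) := by
      refine (iInf₂_le y hyU).trans ?_
      obtain ⟨x, hx', rfl⟩ := hxa
      obtain ⟨y, hy', rfl⟩ := hya
      rw [eucDist_coe, edist_nndist, ENNReal.coe_le_coe, ← NNReal.coe_le_coe, coe_nndist]
      rw [Metric.mem_closedBall] at hx' hy'
      push_cast at hy' ⊢
      linarith [dist_triangle_right x y a]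
    have h2 : φ.ext (distTo x (frontier U)) ≤ (φ (4 * r) : ℝ≥0) := by
      have hne := ne_top_of_le_ne_top ENNReal.coe_ne_top h1
      rw [Gauge.ext, if_neg hne, ENNReal.coe_le_coe]
      exact φ.monotone (ENNReal.toNNReal_le_toNNReal hne ENNReal.coe_ne_top |>.2 h1)
    refine hφR.not_ge (le_add_of_distTo_le (S := carrier (bdry p g))
      (fun w hw => (mem_chainsIn_iff.1 hz.1 hw).2) hxa ((hgφ x hx).trans h2))

theorem homologyMap_mk_eq_zero_iff {X : Type} [TopologicalSpace X] {A B : Set X} (h : A ⊆ B)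
    (p : ℕ) (z : cyclesIn A p) :
    homologyMap h p (QuotientAddGroup.mk z) = 0 ↔ (z : Chain X p) ∈ boundariesIn B p := by
  exact QuotientAddGroup.eq_zero_iff (N := (boundariesIn B p).addSubgroupOf (cyclesIn B p))
    (AddSubgroup.inclusion (inf_le_inf_right _ (chainsIn_mono h p)) z)

end Join

end JohnJoin
end

theorem theorem5p3 (φ : JohnJoin.Gauge) :
    ∃ ψ : JohnJoin.Gauge, ∀ n p : ℕ, p + 2 ≤ n →
      ∀ U : Set (JohnJoin.DotE n), JohnJoin.IsJohn p φ U → JohnJoin.IsInnerJoinable p ψ U := by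
  refine ⟨φ.dilate, fun n p hpn U hU a ha r hr => le_antisymm (fun ξ hξ => ?_) fun ξ hξ => ?_⟩
  · induction ξ using QuotientAddGroup.induction_on with
    | H z =>
      refine (JohnJoin.homologyMap_mk_eq_zero_iff _ p z).2 ?_
      have hzU : (z : JohnJoin.Chain (JohnJoin.DotE n) p) ∈ JohnJoin.boundariesIn U p :=
        (JohnJoin.homologyMap_mk_eq_zero_iff Set.sdiff_subset p
          (AddSubgroup.inclusion (inf_le_inf_right _ (JohnJoin.chainsIn_mono
            (JohnJoin.diff_cball_subset U a (φ.dilate.le_apply r)) p)) z)).1 hξ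
      refine hU.mem_boundariesIn hpn ha hr ?_ (φ.add_lt_dilate hr) z.2 hzU
      exact (mul_le_mul_left (by norm_num) r).trans (φ.le_apply (6 * r))
  · rw [AddMonoidHom.mem_ker] at hξ ⊢
    rw [AddMonoidHom.comp_apply, hξ, map_zero]
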